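/- For a meromorphic function $\phi$ on $\mathbb{C}$ let $T(r,\phi)=N(r,\phi)+m(r,\phi)$ be its Nevanlinna characteristic, where $$N(r,\phi)=\int_0^r\frac{n(t,\phi)-n(0,\phi)}{t}\,dt+n(0,\phi)\log r,\qquad m(r,\phi)=\frac1{2\pi}\int_0^{2\pi}\log^+|\phi(re^{i\theta})|\,d\theta,$$ and $n(t,\phi)$ is the number of poles of $\phi$ in $|z|\le t$, counted with multiplicity. Let $m\ge 0$ be an integer, let $s_0,\dots,s_m$ be distinct complex numbers, and let $f(s,z_0,\dots,z_m)=\sum_{k}\phi_k(s)\,z_0^{k_0}\cdots z_m^{k_m}$ (a finite sum over multi-indices $k\in\mathbb{Z}_{\ge0}^{m+1}$) be a polynomial in $z_0,\dots,z_m$ whose coefficients $\phi_k$ are meromorphic functions on $\mathbb{C}$ with $T(r,\phi_k)=o(r)$ as $r\to\infty$. If $$f(s,\zeta(s+s_0),\dots,\zeta(s+s_m))=0$$ identically in $s\in\mathbb{C}$ (as an identity between meromorphic functions, that is, outside a closed discrete set), then $f$ is identically zero: every coefficient $\phi_k$ is the zero meromorphic function. In particular, if the coefficients $\phi_k$ are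 rational functions of $s$ and this identity holds, then $f=0$, so $\zeta$ satisfies no nontrivial algebraic difference equation with rational coefficients. -/

import Mathlib

open Filter
open scoped Asymptotics

/-- The function `s ↦ f(s, ζ(s + σ₀), …, ζ(s + σ_m))`, for a polynomial `f` in `m + 1` variables
whose coefficients are functions of the complex variable `s`. -/
noncomputable def zetaDifferencePolynomial {m : ℕ} (σ : Fin (m + 1) → ℂ)
    (f : MvPolynomial (Fin (m + 1)) (ℂ → ℂ)) : ℂ → ℂ :=
  fun s ↦ ∑ k ∈ f.support, f.coeff k s * ∏ i, riemannZeta (s + σ i) ^ k i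

/-- The same function for a polynomial whose coefficients are rational functions of `s`; the value
is the intended one at every `s` that is not a pole of a coefficient. -/
noncomputable def zetaDifferencePolynomialRat {m : ℕ} (σ : Fin (m + 1) → ℂ)
    (f : MvPolynomial (Fin (m + 1)) (RatFunc ℂ)) : ℂ → ℂ :=
  fun s ↦ ∑ k ∈ f.support,
    (f.coeff k).eval (RingHom.id ℂ) s * ∏ i, riemannZeta (s + σ i) ^ k i

/-! Far to the right each monomial in the shifted zetas is a Dirichlet series with multiplicative
coefficients `a k n`. If the identity holds but some formal coefficient `c = ∑ a k n * φ k` is not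
zero, take the least such `n`. The tails of the series give `|c| * n ^ (-Re s) ≤ B * (n + 1) ^ (-Re
s) * ∑ |φ k|`, so `log⁺ |1 / c| + ∑ log⁺ |φ k|` dominates a positive multiple of `Re s`, up to a
constant, in a right half-plane. Averaged over `|s| = r` this contradicts the growth `o(r)` of the
characteristics, the first main theorem covering `1 / c`
(`sum_coeff_mul_eventuallyEq_zero_of_sum_mul_LSeries`).

Hence `∑ a k n * φ k = 0` for every `n`. Multiplicative functions that differ pairwise at powers of
infinitely many primes are independent, by a Dedekind-style elimination
(`ArithmeticFunction.eventuallyEq_zero_of_sum_eventuallyEq_zero`). They do differ: for almost all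
`p` the numbers `p ^ (-σ i)` are distinct, and the Euler factor at `p` then determines the exponents
`k`. -/

/-! ### Euler factors at primes that separate the shifts -/

/-- If `p ^ (-s) = p ^ (-t)` for two different primes `p`, then `s = t`. -/
lemma subsingleton_prime_cpow_neg_eq {s t : ℂ} (hst : s ≠ t) :
    {p : ℕ | p.Prime ∧ (p : ℂ) ^ (-s) = (p : ℂ) ^ (-t)}.Subsingleton := by
  have key : ∀ p : ℕ, p.Prime → (p : ℂ) ^ (-s) = (p : ℂ) ^ (-t) →
      ∃ n : ℤ, n ≠ 0 ∧ (s - t) * (Real.log p : ℂ) = n * (2 * Real.pi * Complex.I) := by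
    intro p hp h
    have hp0 : (p : ℂ) ≠ 0 := by exact_mod_cast hp.ne_zero
    rw [Complex.cpow_def_of_ne_zero hp0, Complex.cpow_def_of_ne_zero hp0,
      Complex.exp_eq_exp_iff_exists_int] at h
    obtain ⟨n, hn⟩ := h
    simp only [← Complex.natCast_log] at hn
    have hlog : (Real.log p : ℂ) ≠ 0 := by
      exact_mod_cast (Real.log_pos (by exact_mod_cast hp.one_lt)).ne'
    refine ⟨-n, ?_, ?_⟩
    · rintro hn0
      have : n = 0 := by omega
      subst this
      apply hst
      have : (Real.log p : ℂ) * (s - t) = 0 := by rw [Int.cast_zero] at hn; linear_combination -hn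
      exact sub_eq_zero.1 ((mul_eq_zero.1 this).resolve_left hlog)
    · rw [Int.cast_neg]; linear_combination -hn
  rintro p ⟨hp, hps⟩ q ⟨hq, hqs⟩
  obtain ⟨n, hn, hn'⟩ := key p hp hps
  obtain ⟨m, hm, hm'⟩ := key q hq hqs
  have hI : (2 * Real.pi * Complex.I : ℂ) ≠ 0 := Complex.two_pi_I_ne_zero
  -- Eliminating `s - t` leaves a relation between `log p` and `log q`, which unique factorization
  -- forbids for `p ≠ q`.
  have h1 : (m : ℂ) * Real.log p = n * Real.log q := by
    have : (s - t) * (m * Real.log p - n * Real.log q : ℂ) = 0 := by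
      linear_combination (m : ℂ) * hn' - n * hm'
    rcases mul_eq_zero.1 this with h | h
    · exact absurd (sub_eq_zero.1 h) hst
    · exact sub_eq_zero.1 h
  have h2 : (m : ℝ) * Real.log p = n * Real.log q := by exact_mod_cast h1
  have h3 : (m.natAbs : ℝ) * Real.log p = n.natAbs * Real.log q := by
    have := congrArg abs h2
    rwa [abs_mul, abs_mul, abs_of_pos (Real.log_pos (by exact_mod_cast hp.one_lt)),
      abs_of_pos (Real.log_pos (by exact_mod_cast hq.one_lt)), ← Int.cast_abs, ← Int.cast_abs,
      Int.abs_eq_natAbs, Int.abs_eq_natAbs, Int.cast_natCast, Int.cast_natCast] at this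
  rw [← Real.log_pow, ← Real.log_pow] at h3
  have h4 : (p : ℝ) ^ m.natAbs = (q : ℝ) ^ n.natAbs :=
    Real.log_injOn_pos (Set.mem_Ioi.2 (by have := hp.pos; positivity))
      (Set.mem_Ioi.2 (by have := hq.pos; positivity)) h3
  have h5 : p ^ m.natAbs = q ^ n.natAbs := by exact_mod_cast h4
  have h6 : p ∣ q ^ n.natAbs := h5 ▸ dvd_pow_self p (Int.natAbs_ne_zero.2 hm)
  exact (Nat.prime_dvd_prime_iff_eq hp hq).1 (hp.dvd_of_dvd_pow h6)

/-- All but finitely many primes separate finitely many distinct exponents. -/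
lemma finite_prime_not_injective_cpow_neg {ι : Type*} [Finite ι] {σ : ι → ℂ}
    (hσ : Function.Injective σ) :
    {p : ℕ | p.Prime ∧ ¬ Function.Injective fun i ↦ (p : ℂ) ^ (-σ i)}.Finite := by
  have : {p : ℕ | p.Prime ∧ ¬ Function.Injective fun i ↦ (p : ℂ) ^ (-σ i)} ⊆
      ⋃ ij : {ij : ι × ι // ij.1 ≠ ij.2},
        {p : ℕ | p.Prime ∧ (p : ℂ) ^ (-σ ij.1.1) = (p : ℂ) ^ (-σ ij.1.2)} := by
    rintro p ⟨hp, h⟩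
    simp only [Function.Injective, not_forall] at h
    obtain ⟨i, j, hij, hne⟩ := h
    exact Set.mem_iUnion.2 ⟨⟨(i, j), hne⟩, hp, hij⟩
  refine (Set.finite_iUnion fun ij ↦ ?_).subset this
  exact (subsingleton_prime_cpow_neg_eq (hσ.ne ij.2)).finite

namespace ArithmeticFunction

/-- The generating power series `∑ f(p ^ e) X ^ e` of an arithmetic function at a prime `p`. -/
noncomputable def atPrime (p : ℕ) [hp : Fact p.Prime] : ArithmeticFunction ℂ →* PowerSeries ℂ where
  toFun f := PowerSeries.mk fun e ↦ f (p ^ e)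
  map_one' := by
    ext e
    rw [PowerSeries.coeff_mk, PowerSeries.coeff_one, one_apply]
    simp [hp.out.one_lt.ne']
  map_mul' f g := by
    ext e
    rw [PowerSeries.coeff_mk, PowerSeries.coeff_mul, mul_apply,
      Nat.sum_divisorsAntidiagonal fun i j ↦ f i * g j, Nat.divisors_prime_pow hp.out,
      Finset.sum_map, Finset.Nat.sum_antidiagonal_eq_sum_range_succ_mk]
    refine Finset.sum_congr rfl fun i hi ↦ ?_
    simp only [Function.Embedding.coeFn_mk, PowerSeries.coeff_mk]
    rw [Nat.pow_div (Finset.mem_range_succ_iff.1 hi) hp.out.pos]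

lemma coeff_atPrime (p : ℕ) [Fact p.Prime] (f : ArithmeticFunction ℂ) (e : ℕ) :
    (atPrime p f).coeff e = f (p ^ e) :=
  PowerSeries.coeff_mk e fun e ↦ f (p ^ e)

/-- The arithmetic function `n ↦ n ^ (-t)`, whose Dirichlet series is `ζ(s + t)`. -/
noncomputable def cpowNeg (t : ℂ) : ArithmeticFunction ℂ :=
  ⟨fun n ↦ if n = 0 then 0 else (n : ℂ) ^ (-t), by simp⟩

lemma cpowNeg_apply {t : ℂ} {n : ℕ} (hn : n ≠ 0) : cpowNeg t n = (n : ℂ) ^ (-t) := by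
  simp [cpowNeg, hn]

lemma isMultiplicative_cpowNeg (t : ℂ) : (cpowNeg t).IsMultiplicative := by
  refine IsMultiplicative.iff_ne_zero.2 ⟨by simp [cpowNeg], fun {m n} hm hn _ ↦ ?_⟩
  rw [cpowNeg_apply (mul_ne_zero hm hn), cpowNeg_apply hm, cpowNeg_apply hn, Nat.cast_mul,
    Complex.natCast_mul_natCast_cpow]

/-- Geometric series: the local factor of `ζ(s + t)` at `p`. -/
lemma one_sub_mul_atPrime_cpowNeg (p : ℕ) [hp : Fact p.Prime] (t : ℂ) :
    ((1 - Polynomial.C ((p : ℂ) ^ (-t)) * Polynomial.X : Polynomial ℂ) : PowerSeries ℂ) *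
      atPrime p (cpowNeg t) = 1 := by
  have hval : ∀ e, cpowNeg t (p ^ e) = ((p : ℂ) ^ (-t)) ^ e := fun e ↦ by
    rw [cpowNeg_apply (pow_ne_zero _ hp.out.ne_zero), Nat.cast_pow, ← Complex.cpow_nat_mul,
      ← Complex.natCast_cpow_natCast_mul, mul_comm]
  ext e
  simp only [Polynomial.coe_sub, Polynomial.coe_one, Polynomial.coe_mul, Polynomial.coe_C,
    Polynomial.coe_X, sub_mul, one_mul, map_sub, mul_assoc, PowerSeries.coeff_C_mul,
    coeff_atPrime, hval]
  cases e with
  | zero => simp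
  | succ e => simp [PowerSeries.coeff_succ_X_mul, coeff_atPrime, hval, PowerSeries.coeff_one,
      pow_succ']

end ArithmeticFunction

/-- The multiset of roots determines the exponents of a product of distinct linear factors. -/
lemma Polynomial.injective_prod_one_sub_pow {ι : Type*} [Fintype ι] {w : ι → ℂ}
    (hw : Function.Injective w) (hw0 : ∀ i, w i ≠ 0) {k l : ι → ℕ}
    (h : ∏ i, (1 - C (w i) * X) ^ k i = ∏ i, (1 - C (w i) * X) ^ l i) : k = l := by
  classical
  have hlin : ∀ i, (1 - C (w i) * X : Polynomial ℂ) = C (-w i) * X + C 1 := fun i ↦ by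
    simp; ring
  have hne : ∀ i, (1 - C (w i) * X : Polynomial ℂ) ≠ 0 := fun i h0 ↦ by
    simpa using congrArg (Polynomial.eval 0) h0
  have hroots : ∀ k : ι → ℕ, ∀ j,
      (∏ i, (1 - C (w i) * X : Polynomial ℂ) ^ k i).roots.count (w j)⁻¹ = k j := by
    intro k j
    rw [Polynomial.roots_prod _ _ (Finset.prod_ne_zero_iff.2 fun i _ ↦ pow_ne_zero _ (hne i)),
      Multiset.count_bind]
    have : ∀ i, ((1 - C (w i) * X : Polynomial ℂ) ^ k i).roots.count (w j)⁻¹ =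
        if i = j then k j else 0 := by
      intro i
      rw [Polynomial.roots_pow, Multiset.count_nsmul, hlin,
        Polynomial.roots_C_mul_X_add_C _ (neg_ne_zero.2 (hw0 i)), Multiset.count_singleton]
      by_cases hij : i = j
      · subst hij; simp [inv_neg]
      · have : (w j)⁻¹ ≠ (w i)⁻¹ := fun h ↦ hij (hw (inv_injective h)).symm
        simp [hij, inv_neg, this]
    simp only [this]
    change ∑ i, (if i = j then k j else 0) = k j
    simp
  funext j
  rw [← hroots k j, h, hroots l j]

/-- The coefficients of the Dirichlet series `∏ i, ζ(s + σ i) ^ k i`. -/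
noncomputable def shiftedZetaMonomial {ι : Type*} [Fintype ι] (σ : ι → ℂ) (k : ι →₀ ℕ) :
    ArithmeticFunction ℂ :=
  ∏ i, ArithmeticFunction.cpowNeg (σ i) ^ k i

lemma isMultiplicative_shiftedZetaMonomial {ι : Type*} [Fintype ι] (σ : ι → ℂ) (k : ι →₀ ℕ) :
    (shiftedZetaMonomial σ k).IsMultiplicative :=
  ArithmeticFunction.isMultiplicative_finsetProd _ _ fun i _ ↦
    (ArithmeticFunction.isMultiplicative_cpowNeg (σ i)).pow

/-- If all values agreed, the Euler factors at `p` would have equal inverses, and these are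
polynomials whose root multiplicities are the exponents. -/
lemma exists_shiftedZetaMonomial_prime_pow_ne {ι : Type*} [Fintype ι] {σ : ι → ℂ} {p : ℕ}
    (hp : p.Prime) (hσ : Function.Injective fun i ↦ (p : ℂ) ^ (-σ i)) {k l : ι →₀ ℕ}
    (hkl : k ≠ l) :
    ∃ e, shiftedZetaMonomial σ k (p ^ e) ≠ shiftedZetaMonomial σ l (p ^ e) := by
  have : Fact p.Prime := ⟨hp⟩
  by_contra! h
  have hser : ArithmeticFunction.atPrime p (shiftedZetaMonomial σ k) =
      ArithmeticFunction.atPrime p (shiftedZetaMonomial σ l) := by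
    ext e; simpa only [ArithmeticFunction.coeff_atPrime] using h e
  have hinv : ∀ k : ι →₀ ℕ,
      ((∏ i, (1 - Polynomial.C ((p : ℂ) ^ (-σ i)) * Polynomial.X : Polynomial ℂ) ^ k i :
        Polynomial ℂ) : PowerSeries ℂ) *
        ArithmeticFunction.atPrime p (shiftedZetaMonomial σ k) = 1 := by
    intro k
    rw [← Polynomial.coeToPowerSeries.ringHom_apply, map_prod, shiftedZetaMonomial, map_prod,
      ← Finset.prod_mul_distrib]
    refine Finset.prod_eq_one fun i _ ↦ ?_
    rw [map_pow, map_pow, ← mul_pow, Polynomial.coeToPowerSeries.ringHom_apply,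
      ArithmeticFunction.one_sub_mul_atPrime_cpowNeg, one_pow]
  have hk := hinv k
  rw [hser] at hk
  have hpoly := Polynomial.coe_injective ℂ <|
    (left_inv_eq_right_inv hk ((mul_comm _ _).trans (hinv l)))
  refine hkl (DFunLike.coe_injective
    (Polynomial.injective_prod_one_sub_pow hσ (fun i ↦ ?_) hpoly))
  simp [Complex.cpow_eq_zero_iff, hp.ne_zero]

/-! ### Independence of multiplicative functions -/

/-- A family of multiplicative functions, any two of which differ at powers of infinitely many
primes, is linearly independent, also over germs of functions along a filter. -/
lemma ArithmeticFunction.eventuallyEq_zero_of_sum_eventuallyEq_zero {ι X : Type*} {l : Filter X}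
    {a : ι → ArithmeticFunction ℂ} (ha : ∀ k, (a k).IsMultiplicative)
    (hsep : ∀ k j, k ≠ j → {p : ℕ | p.Prime ∧ ∃ e, a k (p ^ e) ≠ a j (p ^ e)}.Infinite)
    (S : Finset ι) (c : ι → X → ℂ) {N : ℕ} (hN : N ≠ 0)
    (h : ∀ n, n.Coprime N → ∀ᶠ x in l, ∑ k ∈ S, a k n * c k x = 0) :
    ∀ k ∈ S, c k =ᶠ[l] 0 := by
  classical
  induction S using Finset.induction_on generalizing c N with
  | empty => simp
  | insert j S hj ih =>
    have hS : ∀ k ∈ S, c k =ᶠ[l] 0 := by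
      intro k hk
      obtain ⟨p, ⟨hp, e, he⟩, hpN⟩ :=
        (hsep k j (ne_of_mem_of_not_mem hk hj)).exists_notMem_finset N.primeFactors
      have hpN' : p.Coprime N := (Nat.Prime.coprime_iff_not_dvd hp).2 fun hd ↦
        hpN (Nat.mem_primeFactors.2 ⟨hp, hd, hN⟩)
      -- Subtracting `a j (p ^ e)` times the relation at `n` from the one at `n * p ^ e` removes the
      -- index `j`. Multiplicativity needs `n` prime to `p`, so `N` grows to `N * p`.
      have := ih (fun k x ↦ (a k (p ^ e) - a j (p ^ e)) * c k x) (N := N * p)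
        (mul_ne_zero hN hp.ne_zero) (fun n hn ↦ by
          obtain ⟨hn1, hn2⟩ := Nat.coprime_mul_iff_right.1 hn
          have hcop : n.Coprime (p ^ e) := Nat.Coprime.pow_right e hn2
          filter_upwards [h n hn1, h (n * p ^ e) (Nat.Coprime.mul_left hn1 (hpN'.pow_left e))]
            with x h1 h2
          simp only [(ha _).map_mul_of_coprime hcop] at h2
          rw [Finset.sum_insert hj] at h1 h2
          have h3 : ∑ k ∈ S, a k n * ((a k (p ^ e) - a j (p ^ e)) * c k x) =
              ∑ k ∈ S, a k n * a k (p ^ e) * c k x - a j (p ^ e) * ∑ k ∈ S, a k n * c k x := by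
            rw [Finset.mul_sum, ← Finset.sum_sub_distrib]
            exact Finset.sum_congr rfl fun k _ ↦ by ring
          rw [h3]
          linear_combination h2 - a j (p ^ e) * h1) k hk
      filter_upwards [this] with x hx
      simpa [sub_ne_zero.2 he] using hx
    intro k hk
    rcases Finset.mem_insert.1 hk with rfl | hk
    · filter_upwards [h 1 (Nat.coprime_one_left N), (Finset.eventually_all S).2 hS] with x h1 h2
      rw [Finset.sum_insert hj, Finset.sum_eq_zero (fun i hi ↦ by simp [h2 i hi])] at h1
      simpa [(ha k).map_one] using h1
    · exact hS k hk

/-! ### Meromorphic dichotomy and Dirichlet tails -/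

/-- Identity theorem: as `ℂ` is connected, the order is infinite everywhere or nowhere. -/
lemma Meromorphic.eventually_ne_zero_or_eventuallyEq_zero {f : ℂ → ℂ} (hf : Meromorphic f) :
    (∀ z, meromorphicOrderAt f z ≠ ⊤) ∧ (∀ᶠ z in codiscrete ℂ, f z ≠ 0) ∨
      f =ᶠ[codiscrete ℂ] 0 := by
  by_cases h : ∃ u : (Set.univ : Set ℂ), meromorphicOrderAt f u ≠ ⊤
  · have h' := (hf.meromorphicOn.exists_meromorphicOrderAt_ne_top_iff_forall isConnected_univ).1 h
    have h'' : ∀ z, meromorphicOrderAt f z ≠ ⊤ := fun z ↦ h' ⟨z, trivial⟩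
    exact Or.inl ⟨h'', hf.meromorphicOn.eventually_codiscreteWithin_apply_ne_zero fun z _ ↦ h'' z⟩
  · right
    push Not at h
    refine mem_codiscrete.2 fun x ↦ ?_
    rw [Filter.disjoint_principal_right, compl_compl]
    exact meromorphicOrderAt_eq_top_iff.1 (h ⟨x, trivial⟩)

/-- The difference between a Dirichlet series and its partial sum decays like the next term. -/
lemma LSeriesSummable.exists_norm_sub_sum_range_le {a : ℕ → ℂ} {x : ℝ}
    (ha : LSeriesSummable a x) (N : ℕ) :
    ∃ M : ℝ, 0 ≤ M ∧ ∀ s : ℂ, x ≤ s.re →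
      ‖LSeries a s - ∑ n ∈ Finset.range (N + 1), LSeries.term a s n‖ ≤
        M * ((N : ℝ) + 1) ^ (-s.re) := by
  have hN : (0 : ℝ) < (N : ℝ) + 1 := by positivity
  refine ⟨((N : ℝ) + 1) ^ x * ∑' n, ‖LSeries.term a x (n + (N + 1))‖,
    mul_nonneg (by positivity) (tsum_nonneg fun _ ↦ norm_nonneg _), fun s hs ↦ ?_⟩
  have hsum : LSeriesSummable a s := ha.of_re_le_re (by simpa using hs)
  have hx : Summable fun n ↦ ‖LSeries.term a x (n + (N + 1))‖ :=
    ((summable_nat_add_iff (N + 1)).2 ha).norm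
  have hsx : Summable fun n ↦ ‖LSeries.term a s (n + (N + 1))‖ :=
    ((summable_nat_add_iff (N + 1)).2 hsum).norm
  have hterm : ∀ n : ℕ, ‖LSeries.term a s (n + (N + 1))‖ ≤
      ((N : ℝ) + 1) ^ (x - s.re) * ‖LSeries.term a x (n + (N + 1))‖ := by
    intro n
    have hpos : (0 : ℝ) < ((n + (N + 1) : ℕ) : ℝ) := by positivity
    rw [LSeries.norm_term_eq, LSeries.norm_term_eq, if_neg (by omega), if_neg (by omega),
      Complex.ofReal_re]
    have h1 : (((n + (N + 1) : ℕ) : ℝ)) ^ (x - s.re) ≤ ((N : ℝ) + 1) ^ (x - s.re) :=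
      Real.rpow_le_rpow_of_nonpos hN (by push_cast; linarith [n.cast_nonneg (α := ℝ)])
        (by linarith)
    have h2 : ‖a (n + (N + 1))‖ / ((n + (N + 1) : ℕ) : ℝ) ^ s.re =
        ((n + (N + 1) : ℕ) : ℝ) ^ (x - s.re) *
          (‖a (n + (N + 1))‖ / ((n + (N + 1) : ℕ) : ℝ) ^ x) := by
      rw [Real.rpow_sub hpos]
      field_simp
    rw [h2]
    gcongr
  have h1 : LSeries a s - ∑ n ∈ Finset.range (N + 1), LSeries.term a s n =
      ∑' n, LSeries.term a s (n + (N + 1)) := by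
    rw [LSeries, ← hsum.sum_add_tsum_nat_add (N + 1), add_sub_cancel_left]
  rw [h1]
  calc ‖∑' n, LSeries.term a s (n + (N + 1))‖
      ≤ ∑' n, ‖LSeries.term a s (n + (N + 1))‖ := norm_tsum_le_tsum_norm hsx
    _ ≤ ∑' n, ((N : ℝ) + 1) ^ (x - s.re) * ‖LSeries.term a x (n + (N + 1))‖ :=
        hsx.tsum_le_tsum hterm (hx.mul_left _)
    _ = ((N : ℝ) + 1) ^ x * (∑' n, ‖LSeries.term a x (n + (N + 1))‖) *
          ((N : ℝ) + 1) ^ (-s.re) := by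
        rw [tsum_mul_left, sub_eq_add_neg, Real.rpow_add hN]; ring

/-! ### Circle averages and functions of characteristic `o(r)` -/

/-- On `|s| = r` the function `(Re s + (Re s) ^ 2 / r) / 2` is a trigonometric polynomial lying
below `max (Re s) 0`, yet its mean `r / 4` is still linear in `r`. -/
lemma circleAverage_re_add_re_sq (r δ C : ℝ) :
    Real.circleAverage (fun s : ℂ ↦ δ * ((s.re + s.re ^ 2 / r) / 2) - C) 0 r = δ * r / 4 - C := by
  have h : ∀ θ : ℝ, δ * (((circleMap 0 r θ).re + (circleMap 0 r θ).re ^ 2 / r) / 2) - C =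
      δ * r / 2 * Real.cos θ + δ * r / 2 * Real.cos θ ^ 2 - C := by
    intro θ
    simp only [circleMap_zero_re]
    rcases eq_or_ne r 0 with rfl | hr
    · simp
    · field_simp
  rw [Real.circleAverage]
  simp only [h]
  rw [intervalIntegral.integral_sub, intervalIntegral.integral_add,
    intervalIntegral.integral_const_mul, intervalIntegral.integral_const_mul, integral_cos,
    integral_cos_sq, intervalIntegral.integral_const]
  · simp
    field_simp
    ring
  all_goals exact Continuous.intervalIntegrable (by fun_prop) _ _

/-- Replacing `f` by `min f g` changes it only on a discrete subset of the circle, which the average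
ignores. -/
lemma circleAverage_le_of_eventually_codiscrete {f g : ℂ → ℝ} {r : ℝ} (hr : r ≠ 0)
    (hf : CircleIntegrable f 0 r) (hg : CircleIntegrable g 0 r)
    (h : ∀ᶠ s in codiscrete ℂ, s ∈ Metric.sphere (0 : ℂ) |r| → f s ≤ g s) :
    Real.circleAverage f 0 r ≤ Real.circleAverage g 0 r := by
  have hle : codiscreteWithin (Metric.sphere (0 : ℂ) |r|) ≤ codiscrete ℂ :=
    codiscreteWithin_mono (Set.subset_univ _)
  have heq : (fun s ↦ min (f s) (g s)) =ᶠ[codiscreteWithin (Metric.sphere (0 : ℂ) |r|)] f := by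
    filter_upwards [hle h, self_mem_codiscreteWithin _] with s hs hs'
    exact min_eq_left (hs hs')
  rw [← Real.circleAverage_congr_codiscreteWithin heq hr]
  refine Real.circleAverage_mono ?_ hg fun s _ ↦ min_le_right _ _
  exact hf.congr_codiscreteWithin heq.symm

namespace ValueDistribution

lemma isLittleO_characteristic_of_eventuallyEq_zero {f : ℂ → ℂ} (hf : f =ᶠ[codiscrete ℂ] 0) :
    characteristic f ⊤ =o[atTop] (fun r : ℝ ↦ r) := by
  refine (Asymptotics.isLittleO_zero (fun r : ℝ ↦ r) atTop).congr' ?_ EventuallyEq.rfl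
  filter_upwards [eventually_gt_atTop 0] with r hr
  rw [characteristic_congr_codiscrete hf hr.ne']
  have : (0 : ℂ → ℂ) = fun _ ↦ 0 := rfl
  simp [characteristic, this]

lemma isLittleO_of_nonneg_of_le {f g : ℝ → ℝ} (hg : g =o[atTop] (fun r : ℝ ↦ r))
    (hf : ∀ᶠ r in atTop, 0 ≤ f r) (h : ∀ᶠ r in atTop, f r ≤ g r) :
    f =o[atTop] (fun r : ℝ ↦ r) := by
  refine Asymptotics.IsBigO.trans_isLittleO (Asymptotics.IsBigO.of_bound 1 ?_) hg
  filter_upwards [hf, h] with r h1 h2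
  rw [Real.norm_of_nonneg h1, Real.norm_of_nonneg (h1.trans h2), one_mul]
  exact h2

lemma isLittleO_const_id (c : ℝ) : (fun _ : ℝ ↦ c) =o[atTop] (fun r : ℝ ↦ r) :=
  Asymptotics.isLittleO_const_id_atTop c

lemma isLittleO_characteristic_mul {f g : ℂ → ℂ} (hf : Meromorphic f) (hg : Meromorphic g)
    (hfT : characteristic f ⊤ =o[atTop] (fun r : ℝ ↦ r))
    (hgT : characteristic g ⊤ =o[atTop] (fun r : ℝ ↦ r)) :
    characteristic (f * g) ⊤ =o[atTop] (fun r : ℝ ↦ r) := by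
  rcases hf.eventually_ne_zero_or_eventuallyEq_zero with ⟨hf', -⟩ | hf0
  · rcases hg.eventually_ne_zero_or_eventuallyEq_zero with ⟨hg', -⟩ | hg0
    · exact isLittleO_of_nonneg_of_le (hfT.add hgT) characteristic_eventually_nonneg
        (characteristic_mul_top_eventuallyLE hf hf' hg hg')
    · refine isLittleO_characteristic_of_eventuallyEq_zero ?_
      filter_upwards [hg0] with z hz using by simp [hz]
  · refine isLittleO_characteristic_of_eventuallyEq_zero ?_
    filter_upwards [hf0] with z hz using by simp [hz]

lemma isLittleO_characteristic_const (c : ℂ) :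
    characteristic (fun _ ↦ c) ⊤ =o[atTop] (fun r : ℝ ↦ r) := by
  refine (isLittleO_const_id (Real.posLog ‖c‖)).congr_left fun r ↦ ?_
  simp [characteristic]

lemma isLittleO_characteristic_sum {ι : Type*} {S : Finset ι} {f : ι → ℂ → ℂ}
    (hf : ∀ k ∈ S, Meromorphic (f k))
    (hfT : ∀ k ∈ S, characteristic (f k) ⊤ =o[atTop] (fun r : ℝ ↦ r)) :
    characteristic (∑ k ∈ S, f k) ⊤ =o[atTop] (fun r : ℝ ↦ r) :=
  isLittleO_of_nonneg_of_le ((Asymptotics.IsLittleO.sum hfT).add (isLittleO_const_id _))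
    characteristic_eventually_nonneg (characteristic_sum_top_eventuallyLE S f hf)

/-- First main theorem: the characteristics of `f` and `f⁻¹` differ by `O(1)`. -/
lemma isLittleO_characteristic_inv {f : ℂ → ℂ} (hf : Meromorphic f)
    (hfT : characteristic f ⊤ =o[atTop] (fun r : ℝ ↦ r)) :
    characteristic f⁻¹ ⊤ =o[atTop] (fun r : ℝ ↦ r) := by
  have h := (isBigO_characteristic_sub_characteristic_inv hf).trans_isLittleO
    (isLittleO_const_id 1)
  exact (hfT.sub h).congr_left fun r ↦ by simp

lemma isLittleO_proximity {f : ℂ → ℂ} (hfT : characteristic f ⊤ =o[atTop] (fun r : ℝ ↦ r)) :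
    proximity f ⊤ =o[atTop] (fun r : ℝ ↦ r) := by
  refine isLittleO_of_nonneg_of_le hfT (Eventually.of_forall fun r ↦ proximity_nonneg r) ?_
  filter_upwards [eventually_ge_atTop 1] with r hr
  exact le_add_of_nonneg_right (logCounting_nonneg hr)

/-- Proximity functions of order `o(r)` cannot dominate a positive multiple of the real part. -/
lemma not_eventually_re_le_sum_posLog {ι : Type*} {S : Finset ι} {f : ι → ℂ → ℂ}
    (hf : ∀ k ∈ S, Meromorphic (f k))
    (hfT : ∀ k ∈ S, characteristic (f k) ⊤ =o[atTop] (fun r : ℝ ↦ r))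
    {δ C x : ℝ} (hδ : 0 < δ) :
    ¬ ∀ᶠ s in codiscrete ℂ, x ≤ s.re → δ * s.re - C ≤ ∑ k ∈ S, Real.posLog ‖f k s‖ := by
  intro h
  -- The term `δ * |x|` absorbs the points with `0 ≤ Re s ≤ x`, where the hypothesis says nothing.
  set C' := |C| + δ * |x|
  have hC' : 0 ≤ C' := by positivity
  have hbound : ∀ r > 0, δ * r / 4 - C' ≤ ∑ k ∈ S, proximity (f k) ⊤ r := by
    intro r hr
    have hint : ∀ k ∈ S, CircleIntegrable (fun s ↦ Real.posLog ‖f k s‖) 0 r :=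
      fun k hk ↦ (hf k hk).meromorphicOn.circleIntegrable_posLog_norm
    rw [← circleAverage_re_add_re_sq r]
    simp only [proximity_top]
    rw [← Real.circleAverage_fun_sum hint]
    refine circleAverage_le_of_eventually_codiscrete hr.ne' ?_ (.fun_sum _ hint) ?_
    · exact ContinuousOn.circleIntegrable' (Continuous.continuousOn (by fun_prop))
    filter_upwards [h] with s hs hsr
    have hnn : 0 ≤ ∑ k ∈ S, Real.posLog ‖f k s‖ := Finset.sum_nonneg fun _ _ ↦ Real.posLog_nonneg
    have hre : |s.re| ≤ r := by
      rw [mem_sphere_zero_iff_norm, abs_of_pos hr] at hsr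
      exact hsr ▸ Complex.abs_re_le_norm s
    have hsq : s.re ^ 2 / r ≤ |s.re| := by
      rw [div_le_iff₀ hr, ← sq_abs, sq]
      gcongr
    have hC : C ≤ C' := (le_abs_self C).trans (le_add_of_nonneg_right (by positivity))
    have hx : δ * |x| ≤ C' := le_add_of_nonneg_left (abs_nonneg C)
    rcases le_total 0 s.re with h0 | h0
    · rw [abs_of_nonneg h0] at hsq
      have h1 : δ * ((s.re + s.re ^ 2 / r) / 2) ≤ δ * s.re := by gcongr; linarith
      rcases le_total x s.re with hxs | hxs
      · linarith [hs hxs]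
      · have : δ * s.re ≤ δ * |x| := by gcongr; exact hxs.trans (le_abs_self x)
        linarith
    · rw [abs_of_nonpos h0] at hsq
      have h1 : δ * ((s.re + s.re ^ 2 / r) / 2) ≤ 0 :=
        mul_nonpos_of_nonneg_of_nonpos hδ.le (by linarith)
      linarith
  have hsmall : (fun r ↦ ∑ k ∈ S, proximity (f k) ⊤ r + C') =o[atTop] (fun r : ℝ ↦ r) :=
    (Asymptotics.IsLittleO.fun_sum fun k hk ↦ isLittleO_proximity (hfT k hk)).add
      (isLittleO_const_id C')
  obtain ⟨r, hr, hr0⟩ := ((hsmall.bound (show 0 < δ / 8 by positivity)).and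
    (eventually_gt_atTop 0)).exists
  have h1 := (le_abs_self _).trans hr
  rw [Real.norm_of_nonneg hr0.le] at h1
  have := hbound r hr0
  nlinarith

end ValueDistribution

/-! ### Vanishing of the formal Dirichlet coefficients -/

open ValueDistribution in
/-- If a combination of Dirichlet series with coefficients of characteristic `o(r)` vanishes in a
right half-plane, then so does each of its formal Dirichlet coefficients. -/
theorem sum_coeff_mul_eventuallyEq_zero_of_sum_mul_LSeries {ι : Type*} {S : Finset ι}
    {φ : ι → ℂ → ℂ} (hφ : ∀ k ∈ S, Meromorphic (φ k))
    (hφT : ∀ k ∈ S, characteristic (φ k) ⊤ =o[atTop] (fun r : ℝ ↦ r))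
    {a : ι → ℕ → ℂ} {x : ℝ} (ha : ∀ k ∈ S, LSeriesSummable (a k) x)
    (h : ∀ᶠ s in codiscrete ℂ, x ≤ s.re → ∑ k ∈ S, φ k s * LSeries (a k) s = 0)
    {n : ℕ} (hn : n ≠ 0) :
    (fun s ↦ ∑ k ∈ S, a k n * φ k s) =ᶠ[codiscrete ℂ] 0 := by
  classical
  induction n using Nat.strong_induction_on with
  | _ n ih =>
  set c : ℂ → ℂ := ∑ k ∈ S, (fun _ ↦ a k n) * φ k with hc
  have hcs : ∀ s, c s = ∑ k ∈ S, a k n * φ k s := fun s ↦ by simp [hc]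
  have hcm : Meromorphic c := Meromorphic.sum fun k hk ↦ (Meromorphic.const _).mul (hφ k hk)
  have hcT : characteristic c ⊤ =o[atTop] (fun r : ℝ ↦ r) :=
    isLittleO_characteristic_sum (fun k hk ↦ (Meromorphic.const _).mul (hφ k hk)) fun k hk ↦
      isLittleO_characteristic_mul (Meromorphic.const _) (hφ k hk)
        (isLittleO_characteristic_const _) (hφT k hk)
  rcases hcm.eventually_ne_zero_or_eventuallyEq_zero with ⟨-, hc0⟩ | hc0
  swap
  · filter_upwards [hc0] with s hs
    rw [← hcs, hs]
  exfalso
  choose! M hM0 hM using fun k hk ↦ (ha k hk).exists_norm_sub_sum_range_le n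
  have hsmaller : ∀ᶠ s in codiscrete ℂ, ∀ m ∈ Finset.range n, m ≠ 0 →
      ∑ k ∈ S, a k m * φ k s = 0 := by
    refine (Finset.eventually_all _).2 fun m hm ↦ ?_
    by_cases hm0 : m = 0
    · simp [hm0]
    · filter_upwards [ih m (Finset.mem_range.1 hm) hm0] with s hs _ using hs
  set δ := Real.log (n + 1) - Real.log n
  have hn0 : (0 : ℝ) < n := by positivity
  have hδ : 0 < δ := sub_pos.2 (Real.log_lt_log hn0 (by linarith))
  -- The summand `1` keeps `B` positive, so that `log B` can be split off.
  set B := 1 + ∑ k ∈ S, M k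
  have hB : 0 < B := by have := Finset.sum_nonneg hM0; positivity
  -- The index `none` carries `c⁻¹`; `log S.card` is the cost of bounding the logarithm of a sum by
  -- a sum of `log⁺`.
  refine not_eventually_re_le_sum_posLog (S := Finset.insertNone S)
    (f := fun o : Option ι ↦ o.elim c⁻¹ φ) (δ := δ) (C := Real.log B + Real.log S.card) (x := x) ?_ ?_ hδ ?_
  · rintro (_ | k) hk
    · exact hcm.inv
    · exact hφ k (by simpa using hk)
  · rintro (_ | k) hk
    · exact isLittleO_characteristic_inv hcm hcT
    · exact hφT k (by simpa using hk)
  filter_upwards [h, hc0, hsmaller] with s h1 h2 h3 hs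
  have hpartial : ∑ k ∈ S, φ k s * ∑ m ∈ Finset.range (n + 1), LSeries.term (a k) s m =
      c s / (n : ℂ) ^ s := by
    simp only [Finset.mul_sum]
    rw [Finset.sum_comm, Finset.sum_range_succ, Finset.sum_eq_zero, zero_add, hcs, Finset.sum_div]
    · refine Finset.sum_congr rfl fun k _ ↦ ?_
      rw [LSeries.term_of_ne_zero hn]; ring
    · intro m hm
      by_cases hm0 : m = 0
      · simp [hm0]
      · simp only [LSeries.term_of_ne_zero hm0]
        rw [← zero_div ((m : ℂ) ^ s), ← h3 m hm hm0, Finset.sum_div]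
        exact Finset.sum_congr rfl fun k _ ↦ by ring
  have hmain : c s / (n : ℂ) ^ s = - ∑ k ∈ S, φ k s *
      (LSeries (a k) s - ∑ m ∈ Finset.range (n + 1), LSeries.term (a k) s m) := by
    simp only [mul_sub, Finset.sum_sub_distrib, h1 hs, hpartial]; ring
  have hΦ : ‖c s‖ / (n : ℝ) ^ s.re ≤ B * ((n : ℝ) + 1) ^ (-s.re) * ∑ k ∈ S, ‖φ k s‖ := by
    rw [← Complex.norm_natCast_cpow_of_pos (Nat.pos_of_ne_zero hn), ← norm_div, hmain, norm_neg,
      Finset.mul_sum]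
    refine norm_sum_le_of_le _ fun k hk ↦ ?_
    rw [norm_mul, mul_comm]
    gcongr
    refine (hM k hk s hs).trans ?_
    gcongr
    exact (Finset.single_le_sum hM0 hk).trans (by simp [B])
  have hcpos : 0 < ‖c s‖ := norm_pos_iff.2 h2
  have hΦpos : 0 < ∑ k ∈ S, ‖φ k s‖ := by
    by_contra! h0
    have : B * ((n : ℝ) + 1) ^ (-s.re) * ∑ k ∈ S, ‖φ k s‖ ≤ 0 :=
      mul_nonpos_of_nonneg_of_nonpos (by positivity) h0
    have : 0 < ‖c s‖ / (n : ℝ) ^ s.re := by positivity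
    linarith
  have hlog := Real.log_le_log (by positivity) hΦ
  rw [Real.log_div (by positivity) (by positivity), Real.log_rpow hn0,
    Real.log_mul (by positivity) hΦpos.ne', Real.log_mul hB.ne' (by positivity),
    Real.log_rpow (by positivity)] at hlog
  rw [Finset.sum_insertNone]
  have h4 : -Real.log ‖c s‖ ≤ Real.posLog ‖c⁻¹ s‖ := by
    rw [Pi.inv_apply, norm_inv, ← Real.log_inv]
    exact le_max_right _ _
  have h5 : Real.log (∑ k ∈ S, ‖φ k s‖) ≤ Real.log S.card + ∑ k ∈ S, Real.posLog ‖φ k s‖ :=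
    (le_max_right 0 _).trans (Real.posLog_sum S _)
  simp only [Option.elim, δ]
  linarith
-- Dirichlet series of the zeta monomials, and independence
lemma ArithmeticFunction.LSeriesHasSum_cpowNeg {s t : ℂ} (hs : 1 < (s + t).re) :
    LSeriesHasSum (fun n ↦ cpowNeg t n) s (riemannZeta (s + t)) := by
  have h := LSeriesHasSum_one hs
  rw [LSeriesHasSum] at h ⊢
  convert h using 1
  ext n
  rcases eq_or_ne n 0 with rfl | hn
  · simp
  · have hn' : (n : ℂ) ≠ 0 := by exact_mod_cast hn
    rw [LSeries.term_of_ne_zero hn, LSeries.term_of_ne_zero hn, cpowNeg_apply hn,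
      Complex.cpow_neg, Complex.cpow_add _ _ hn', Pi.one_apply]
    field_simp

lemma ArithmeticFunction.LSeriesHasSum_one' (s : ℂ) :
    LSeriesHasSum (fun n ↦ (1 : ArithmeticFunction ℂ) n) s 1 := by
  rw [LSeriesHasSum]
  convert hasSum_ite_eq (1 : ℕ) (1 : ℂ) using 1
  ext n
  rcases eq_or_ne n 0 with rfl | hn
  · simp
  · rw [LSeries.term_of_ne_zero hn, one_apply]
    split_ifs with h <;> simp [h]

lemma ArithmeticFunction.LSeriesHasSum_pow {f : ArithmeticFunction ℂ} {s a : ℂ}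
    (hf : LSeriesHasSum (fun n ↦ f n) s a) (k : ℕ) :
    LSeriesHasSum (fun n ↦ (f ^ k) n) s (a ^ k) := by
  induction k with
  | zero => simpa using LSeriesHasSum_one' s
  | succ k ih => rw [pow_succ, pow_succ]; exact LSeriesHasSum_mul ih hf

lemma LSeriesHasSum_shiftedZetaMonomial {ι : Type*} [Fintype ι] {σ : ι → ℂ} {s : ℂ}
    (hs : ∀ i, 1 < (s + σ i).re) (k : ι →₀ ℕ) :
    LSeriesHasSum (fun n ↦ shiftedZetaMonomial σ k n) s (∏ i, riemannZeta (s + σ i) ^ k i) := by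
  classical
  rw [shiftedZetaMonomial]
  induction (Finset.univ : Finset ι) using Finset.induction_on with
  | empty => simpa using ArithmeticFunction.LSeriesHasSum_one' s
  | insert i S hi ih =>
    rw [Finset.prod_insert hi, Finset.prod_insert hi]
    exact ArithmeticFunction.LSeriesHasSum_mul (ArithmeticFunction.LSeriesHasSum_pow
      (ArithmeticFunction.LSeriesHasSum_cpowNeg (hs i)) _) ih

/-- Distinct shifts of the zeta function are algebraically independent over the meromorphic
functions of characteristic `o(r)`. -/
theorem eventuallyEq_zero_of_sum_mul_prod_riemannZeta {ι : Type*} [Fintype ι] {σ : ι → ℂ}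
    (hσ : Function.Injective σ) {S : Finset (ι →₀ ℕ)} {φ : (ι →₀ ℕ) → ℂ → ℂ}
    (hφ : ∀ k ∈ S, Meromorphic (φ k))
    (hφT : ∀ k ∈ S, ValueDistribution.characteristic (φ k) ⊤ =o[atTop] (fun r : ℝ ↦ r))
    (h : ∀ᶠ s in codiscrete ℂ, ∑ k ∈ S, φ k s * ∏ i, riemannZeta (s + σ i) ^ k i = 0) :
    ∀ k ∈ S, φ k =ᶠ[codiscrete ℂ] 0 := by
  -- Far enough right that every `s + σ i` lies in the half-plane of absolute convergence.
  set x : ℝ := 2 + ∑ i, |(σ i).re|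
  have hx : ∀ s : ℂ, x ≤ s.re → ∀ i, 1 < (s + σ i).re := by
    intro s hs i
    have h1 : |(σ i).re| ≤ ∑ i, |(σ i).re| :=
      Finset.single_le_sum (f := fun i ↦ |(σ i).re|) (fun _ _ ↦ abs_nonneg _) (Finset.mem_univ i)
    have h2 := neg_abs_le (σ i).re
    rw [Complex.add_re]
    linarith
  refine ArithmeticFunction.eventuallyEq_zero_of_sum_eventuallyEq_zero
    (isMultiplicative_shiftedZetaMonomial σ) (fun k j hkj ↦ ?_) S φ one_ne_zero fun n _ ↦ ?_
  · refine (Nat.infinite_setOfPred_prime.sdiff (finite_prime_not_injective_cpow_neg hσ)).mono ?_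
    rintro p ⟨hp, hp'⟩
    exact ⟨hp, exists_shiftedZetaMonomial_prime_pow_ne hp (by_contra fun hi ↦ hp' ⟨hp, hi⟩) hkj⟩
  · rcases eq_or_ne n 0 with rfl | hn
    · simp
    refine sum_coeff_mul_eventuallyEq_zero_of_sum_mul_LSeries hφ hφT
      (a := fun k n ↦ shiftedZetaMonomial σ k n) (x := x)
      (fun k _ ↦ (LSeriesHasSum_shiftedZetaMonomial (hx x (by simp)) k).LSeriesSummable) ?_ hn
    filter_upwards [h] with s hs hxs
    rw [← hs]
    exact Finset.sum_congr rfl fun k _ ↦ by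
      rw [(LSeriesHasSum_shiftedZetaMonomial (hx s hxs) k).LSeries_eq]

/-! ### Rational coefficients -/

lemma Polynomial.meromorphic_eval (P : Polynomial ℂ) : Meromorphic fun s ↦ P.eval s :=
  fun s ↦ (P.differentiable.analyticAt s).meromorphicAt

/-- The identity function has no poles and characteristic `log r` for `r ≥ 1`; powers, products and
sums preserve `o(r)`. -/
lemma Polynomial.isLittleO_characteristic_eval (P : Polynomial ℂ) :
    ValueDistribution.characteristic (fun s ↦ P.eval s) ⊤ =o[atTop] (fun r : ℝ ↦ r) := by
  have hmero : Meromorphic fun s : ℂ ↦ s := fun _ ↦ analyticAt_id.meromorphicAt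
  have hid : ValueDistribution.characteristic (fun s : ℂ ↦ s) ⊤ =o[atTop] (fun r : ℝ ↦ r) := by
    have hlog : ValueDistribution.logCounting (fun s : ℂ ↦ s) ⊤ = 0 := by
      rw [ValueDistribution.logCounting_top,
        negPart_eq_zero.2 (MeromorphicOn.AnalyticOnNhd.divisor_nonneg analyticOnNhd_id), map_zero]
    refine Real.isLittleO_log_id_atTop.congr' ?_ EventuallyEq.rfl
    filter_upwards [eventually_ge_atTop 1] with r hr
    rw [ValueDistribution.characteristic, hlog, add_zero, ValueDistribution.proximity_top]
    refine (Real.circleAverage_const_on_circle fun s hs ↦ ?_).symm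
    rw [mem_sphere_zero_iff_norm.1 hs, Real.posLog_eq_log (by simpa using hr.trans (le_abs_self r)), Real.log_abs]
  induction P using Polynomial.induction_on' with
  | add p q hp hq =>
    simp only [Polynomial.eval_add]
    exact ValueDistribution.isLittleO_of_nonneg_of_le
      ((hp.add hq).add (ValueDistribution.isLittleO_const_id (Real.log 2)))
      ValueDistribution.characteristic_eventually_nonneg
      (ValueDistribution.characteristic_add_top_eventuallyLE
        p.meromorphic_eval q.meromorphic_eval)
  | monomial n a =>
    simp only [Polynomial.eval_monomial]
    have hpow : ValueDistribution.characteristic ((fun s : ℂ ↦ s) ^ n) ⊤ =o[atTop]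
        (fun r : ℝ ↦ r) := by
      rw [ValueDistribution.characteristic_pow_top hmero]
      exact (hid.const_mul_left (n : ℝ)).congr_left fun r ↦ by simp
    exact ValueDistribution.isLittleO_characteristic_mul (Meromorphic.const a) (hmero.fun_pow (n := n))
      (ValueDistribution.isLittleO_characteristic_const a) hpow

lemma RatFunc.eval_id_eq (R : RatFunc ℂ) :
    (fun s ↦ R.eval (RingHom.id ℂ) s) =
      (fun s ↦ R.num.eval s) * (fun s ↦ R.denom.eval s)⁻¹ := by
  ext s
  simp [RatFunc.eval, Polynomial.eval₂_id, div_eq_mul_inv]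

lemma RatFunc.meromorphic_eval (R : RatFunc ℂ) :
    Meromorphic fun s ↦ R.eval (RingHom.id ℂ) s := by
  rw [eval_id_eq]
  exact R.num.meromorphic_eval.mul R.denom.meromorphic_eval.inv

lemma RatFunc.isLittleO_characteristic_eval (R : RatFunc ℂ) :
    ValueDistribution.characteristic (fun s ↦ R.eval (RingHom.id ℂ) s) ⊤ =o[atTop]
      (fun r : ℝ ↦ r) := by
  rw [eval_id_eq]
  exact ValueDistribution.isLittleO_characteristic_mul R.num.meromorphic_eval
    R.denom.meromorphic_eval.inv R.num.isLittleO_characteristic_eval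
    (ValueDistribution.isLittleO_characteristic_inv R.denom.meromorphic_eval
      R.denom.isLittleO_characteristic_eval)

lemma RatFunc.eq_zero_of_eval_eventuallyEq_zero {R : RatFunc ℂ}
    (h : (fun s ↦ R.eval (RingHom.id ℂ) s) =ᶠ[codiscrete ℂ] 0) : R = 0 := by
  by_contra hR
  have hroots : ∀ P : Polynomial ℂ, P ≠ 0 → ∀ᶠ s in codiscrete ℂ, P.eval s ≠ 0 := by
    intro P hP
    filter_upwards [(Polynomial.finite_setOfPred_isRoot hP).compl_mem_codiscrete] with s hs using hs
  -- The base point `0` is arbitrary: any punctured neighbourhood contains a point that avoids the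
  -- zeros of numerator and denominator.
  have hall := mem_codiscrete.1 (h.and ((hroots _ (RatFunc.num_ne_zero hR)).and
    (hroots _ R.denom_ne_zero))) 0
  rw [disjoint_principal_right, compl_compl] at hall
  obtain ⟨s, h1, h2, h3⟩ := nonempty_of_mem hall
  rw [eval_id_eq] at h1
  simp [h2, h3] at h1

/-- Equalities of meromorphic functions are read off a discrete closed set
(`=ᶠ[codiscrete ℂ]`), since the values of a meromorphic function at its poles are not meaningful. -/
theorem theorem1 (m : ℕ) (σ : Fin (m + 1) → ℂ) (hσ : Function.Injective σ) :
    (∀ f : MvPolynomial (Fin (m + 1)) (ℂ → ℂ),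
      (∀ k, Meromorphic (f.coeff k)) →
      (∀ k, (ValueDistribution.characteristic (f.coeff k) ⊤) =o[atTop] (fun r : ℝ ↦ r)) →
      zetaDifferencePolynomial σ f =ᶠ[codiscrete ℂ] 0 →
      ∀ k, f.coeff k =ᶠ[codiscrete ℂ] 0) ∧
    (∀ f : MvPolynomial (Fin (m + 1)) (RatFunc ℂ),
      zetaDifferencePolynomialRat σ f =ᶠ[codiscrete ℂ] 0 → f = 0) := by
  constructor
  · intro f hf hfT h k
    by_cases hk : k ∈ f.support
    · exact eventuallyEq_zero_of_sum_mul_prod_riemannZeta hσ (S := f.support) (fun k _ ↦ hf k)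
        (fun k _ ↦ hfT k) h k hk
    · rw [MvPolynomial.notMem_support_iff.1 hk]
  · intro f h
    ext1 k
    by_contra hk
    exact hk <| RatFunc.eq_zero_of_eval_eventuallyEq_zero <|
      eventuallyEq_zero_of_sum_mul_prod_riemannZeta hσ (S := f.support)
        (φ := fun k s ↦ (f.coeff k).eval (RingHom.id ℂ) s)
        (fun k _ ↦ (f.coeff k).meromorphic_eval)
        (fun k _ ↦ (f.coeff k).isLittleO_characteristic_eval) h k (MvPolynomial.mem_support_iff.2 hk)
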